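/- Let $R$ be a (unital, associative) ring which is right semihereditary, i.e. every finitely generated right ideal of $R$ is projective. Let $\mathcal G$ be a Gabriel topology on $R$: a non-empty set of right ideals of $R$, closed under finite intersections and under passing to larger right ideals, such that $(I:x)=\{r\in R\mid xr\in I\}\in\mathcal G$ for all $I\in\mathcal G$ and $x\in R$, and such that a right ideal $K$ belongs to $\mathcal G$ whenever there is $I\in\mathcal G$ with $(K:x)\in\mathcal G$ for all $x\in I$. A right $R$-module $C$ is $\mathcal G$-closed if $\operatorname{Hom}_R(R,C)\to\operatorname{Hom}_R(I,C)$ is bijective for all $I\in\mathcal G$. Let $\lambda_{\mathcal G}\colon R\to Q_{\mathcal G}$ be the canonical ring homomorphism to the ring of quotients, which is the reflection of the right module $R$ in the category of $\mathcal G$-closed modules; explicitly, $Q_{\mathcal G}=\varinjlim_{I\in\mathcal G}\operatorname{Hom}_R(I,R/t(R))$, where $t(R)=\{x\in R\mid xI=0\text{ for some }I\in\mathcal G\}$. Assume that $\mathcal G$ is perfect, i.e. $\lambda_{\mathcal G}(I)Q_{\mathcal G}=Q_{\mathcal G}$ for all $I\in\mathcal G$. Let $(\mathcal T,\mathcal F)$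 be the hereditary torsion pair of right $R$-modules associated to $\mathcal G$, so that $\mathcal G=\{I\le R\mid R/I\in\mathcal T\}$, and let $\mathcal U$ be the class of all finitely presented modules in $\mathcal T$. Then $\lambda_{\mathcal G}$ is an epimorphism of rings, the universal localization of $R$ at $\mathcal U$ exists, and $\lambda_{\mathcal G}$ is equivalent to it: for every universal localization $\lambda_{\mathcal U}\colon R\to R_{\mathcal U}$ of $R$ at $\mathcal U$ there is a ring isomorphism $\varphi\colon Q_{\mathcal G}\to R_{\mathcal U}$ with $\lambda_{\mathcal U}=\varphi\lambda_{\mathcal G}$. Here a ring homomorphism $\lambda\colon R\to S$ is a universal localization of $R$ at $\mathcal U$ if there is a class $\Sigma$ of injective morphisms between finitely generated projective right $R$-modules, each with cokernel in $\mathcal U$ and containing for every $U\in\mathcal U$ some $\alpha\colon P\to Q$ with $0\to P\xrightarrow{\alpha}Q\to U\to0$ exact, such that $\alpha\otimes_RS$ is an isomorphism for all $\alpha\in\Sigma$, and every ring homomorphism $\psi\colon R\to T$ with $\alpha\otimes_RT$ an isomorphism for all $\alpha\in\Sigma$ factors uniquely as $\psi=\bar\psi\lambda$ with a ring homomorphism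 $\bar\psi\colon S\to T$. -/

import Mathlib

open MulOpposite
open scoped TensorProduct

universe u v

/-! Right `R`-modules are modules over `Rᵐᵒᵖ`, so right ideals of `R` are the (left) ideals of
`Rᵐᵒᵖ`, and `op r • m` is `m r`.  A Gabriel topology of right ideals of `R` is therefore
a filter `G : IdealFilter Rᵐᵒᵖ` with `G.IsGabriel`, and `I.colon {op x}` is
`(I : x) = {r | x r ∈ I}`. -/

namespace PerfectLocalization

section Torsion

variable {A : Type u} [Ring A] (G : IdealFilter A)

/-- The torsion submodule: all elements annihilated by an ideal in `G`. -/
def torsionSubmodule [G.IsUniform] (M : Type v) [AddCommGroup M] [Module A M] :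
    Submodule A M where
  carrier := {m | G.IsTorsionElem m}
  add_mem' := by
    rintro x y ⟨L, hL, hx⟩ ⟨L', hL', hy⟩
    refine ⟨L ⊓ L', Order.PFilter.inf_mem hL hL', fun a ha => ?_⟩
    rw [smul_add, hx a ha.1, hy a ha.2, add_zero]
  zero_mem' := by
    obtain ⟨L, hL⟩ := G.nonempty
    exact ⟨L, hL, fun a _ => smul_zero a⟩
  smul_mem' := by
    rintro c x ⟨L, hL, hx⟩
    refine ⟨L.colon {c}, IdealFilter.IsUniform.colon_mem hL c, fun a ha => ?_⟩
    rw [Submodule.mem_colon_singleton] at ha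
    rw [smul_smul]
    exact hx _ ha

variable {N : Type v} [AddCommGroup N] [Module A N]

/-- A submodule `D` of `N` is `G`-dense if `N ⧸ D` is `G`-torsion. -/
def IsDense (D : Submodule A N) : Prop := ∀ n : N, D.colon {n} ∈ G

variable {G}

theorem IsDense.top : IsDense G (⊤ : Submodule A N) := by
  intro n
  obtain ⟨L, hL⟩ := G.nonempty
  exact Order.PFilter.mem_of_le (fun a _ => by simp) hL

theorem IsDense.inf {D E : Submodule A N} (hD : IsDense G D) (hE : IsDense G E) :
    IsDense G (D ⊓ E) := fun n =>
  Order.PFilter.mem_of_le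
    (fun a ha => by
      simp only [Submodule.mem_inf, Submodule.mem_colon_singleton] at ha ⊢
      exact ha)
    (Order.PFilter.inf_mem (hD n) (hE n))

/-- `f` restricts to an `A`-linear map `D → N`. -/
def IsLinearOn (D : Submodule A N) (f : N → N) : Prop :=
  (∀ x ∈ D, ∀ y ∈ D, f (x + y) = f x + f y) ∧ ∀ (a : A), ∀ x ∈ D, f (a • x) = a • f x

theorem IsLinearOn.mono {D E : Submodule A N} {f : N → N} (h : IsLinearOn D f) (hE : E ≤ D) :
    IsLinearOn E f :=
  ⟨fun x hx y hy => h.1 x (hE hx) y (hE hy), fun a x hx => h.2 a x (hE hx)⟩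

/-- The submodule `{x ∈ D | f x ∈ E}`. -/
def preimageOn (D E : Submodule A N) (f : N → N) (hf : IsLinearOn D f) : Submodule A N where
  carrier := {x | x ∈ D ∧ f x ∈ E}
  add_mem' := by
    rintro x y ⟨hx, hx'⟩ ⟨hy, hy'⟩
    exact ⟨D.add_mem hx hy, by rw [hf.1 x hx y hy]; exact E.add_mem hx' hy'⟩
  zero_mem' := by
    refine ⟨D.zero_mem, ?_⟩
    have := hf.2 0 0 D.zero_mem
    rw [zero_smul, zero_smul] at this
    rw [this]; exact E.zero_mem
  smul_mem' := by
    rintro a x ⟨hx, hx'⟩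
    exact ⟨D.smul_mem a hx, by rw [hf.2 a x hx]; exact E.smul_mem a hx'⟩

theorem IsDense.preimageOn [G.IsGabriel] {D E : Submodule A N} (hD : IsDense G D)
    (hE : IsDense G E) {f : N → N} (hf : IsLinearOn D f) :
    IsDense G (preimageOn D E f hf) := by
  intro n
  refine IdealFilter.IsGabriel.gabriel_closed _ ⟨D.colon {n}, hD n, fun a ha => ?_⟩
  rw [Submodule.mem_colon_singleton] at ha
  refine Order.PFilter.mem_of_le (fun b hb => ?_) (hE (f (a • n)))
  rw [Submodule.mem_colon_singleton] at hb ⊢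
  rw [Submodule.mem_colon_singleton, smul_assoc]
  exact ⟨D.smul_mem b ha, by rw [hf.2 b _ ha]; exact hb⟩

end Torsion

section LocalizedEnd

variable {A : Type u} [Ring A] (G : IdealFilter A) (N : Type v) [AddCommGroup N] [Module A N]

/-- Functions that are linear on some `G`-dense submodule (the values elsewhere do not matter). -/
def DensePartialEnd : Type v := {f : N → N // ∃ D : Submodule A N, IsDense G D ∧ IsLinearOn D f}

/-- Two densely defined endomorphisms are identified if they agree on a `G`-dense submodule. -/
def denseSetoid : Setoid (DensePartialEnd G N) where
  r f g := ∃ D : Submodule A N, IsDense G D ∧ ∀ x ∈ D, f.1 x = g.1 x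
  iseqv :=
    { refl := fun _ => ⟨⊤, .top, fun _ _ => rfl⟩
      symm := fun ⟨D, hD, h⟩ => ⟨D, hD, fun x hx => (h x hx).symm⟩
      trans := fun ⟨D, hD, h⟩ ⟨E, hE, h'⟩ =>
        ⟨D ⊓ E, hD.inf hE, fun x hx => (h x hx.1).trans (h' x hx.2)⟩ }

/-- The direct limit of the groups `Hom_A(D, N)` over the `G`-dense submodules `D` of `N`, a ring
under addition and composition of densely defined endomorphisms. -/
def LocalizedEnd : Type v := Quotient (denseSetoid G N)

namespace LocalizedEnd

variable {G N}

/-- The class of a densely defined endomorphism. -/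
def mk (f : N → N) (h : ∃ D : Submodule A N, IsDense G D ∧ IsLinearOn D f) : LocalizedEnd G N :=
  Quotient.mk (denseSetoid G N) ⟨f, h⟩

theorem mk_eq_mk {f g : N → N} {hf hg} :
    (mk f hf : LocalizedEnd G N) = mk g hg ↔
      ∃ D : Submodule A N, IsDense G D ∧ ∀ x ∈ D, f x = g x :=
  ⟨fun h => Quotient.exact h, fun h => Quotient.sound h⟩

theorem ind {p : LocalizedEnd G N → Prop} (h : ∀ f hf, p (mk f hf)) (q : LocalizedEnd G N) :
    p q :=
  Quotient.inductionOn q fun f => h f.1 f.2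

/-- The class of an everywhere defined endomorphism. -/
def ofEnd (φ : N →ₗ[A] N) : LocalizedEnd G N :=
  mk φ ⟨⊤, .top, fun x _ y _ => map_add φ x y, fun a x _ => map_smul φ a x⟩

theorem add_aux {f g : N → N} (hf : ∃ D : Submodule A N, IsDense G D ∧ IsLinearOn D f)
    (hg : ∃ D : Submodule A N, IsDense G D ∧ IsLinearOn D g) :
    ∃ D : Submodule A N, IsDense G D ∧ IsLinearOn D (fun x => f x + g x) := by
  obtain ⟨D, hD, hf⟩ := hf
  obtain ⟨E, hE, hg⟩ := hg
  refine ⟨D ⊓ E, hD.inf hE, fun x hx y hy => ?_, fun a x hx => ?_⟩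
  · simp only [hf.1 x hx.1 y hy.1, hg.1 x hx.2 y hy.2]
    abel
  · simp only [hf.2 a x hx.1, hg.2 a x hx.2, smul_add]

theorem neg_aux {f : N → N} (hf : ∃ D : Submodule A N, IsDense G D ∧ IsLinearOn D f) :
    ∃ D : Submodule A N, IsDense G D ∧ IsLinearOn D (fun x => -f x) := by
  obtain ⟨D, hD, hf⟩ := hf
  refine ⟨D, hD, fun x hx y hy => ?_, fun a x hx => ?_⟩
  · simp only [hf.1 x hx y hy]
    abel
  · simp only [hf.2 a x hx, smul_neg]

theorem mul_aux [G.IsGabriel] {f g : N → N}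
    (hf : ∃ D : Submodule A N, IsDense G D ∧ IsLinearOn D f)
    (hg : ∃ D : Submodule A N, IsDense G D ∧ IsLinearOn D g) :
    ∃ D : Submodule A N, IsDense G D ∧ IsLinearOn D (fun x => f (g x)) := by
  obtain ⟨D, hD, hf⟩ := hf
  obtain ⟨E, hE, hg⟩ := hg
  refine ⟨preimageOn E D g hg, hE.preimageOn hD hg, fun x hx y hy => ?_, fun a x hx => ?_⟩
  · simp only [hg.1 x hx.1 y hy.1, hf.1 _ hx.2 _ hy.2]
  · simp only [hg.2 a x hx.1, hf.2 a _ hx.2]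

instance : Zero (LocalizedEnd G N) := ⟨ofEnd 0⟩
instance : One (LocalizedEnd G N) := ⟨ofEnd LinearMap.id⟩
instance : Neg (LocalizedEnd G N) :=
  ⟨Quotient.lift (fun f => mk (fun x => -f.1 x) (neg_aux f.2)) (by
    rintro f f' ⟨D, hD, h⟩
    exact mk_eq_mk.2 ⟨D, hD, fun x hx => by rw [h x hx]⟩)⟩
instance : Add (LocalizedEnd G N) :=
  ⟨Quotient.lift₂ (fun f g => mk (fun x => f.1 x + g.1 x) (add_aux f.2 g.2)) (by
    rintro f g f' g' ⟨D, hD, h⟩ ⟨E, hE, h'⟩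
    exact mk_eq_mk.2 ⟨D ⊓ E, hD.inf hE, fun x hx => by rw [h x hx.1, h' x hx.2]⟩)⟩
instance [G.IsGabriel] : Mul (LocalizedEnd G N) :=
  ⟨Quotient.lift₂ (fun f g => mk (fun x => f.1 (g.1 x)) (mul_aux f.2 g.2)) (by
    rintro f g f' g' ⟨D, hD, h⟩ ⟨E, hE, h'⟩
    obtain ⟨K, hK, hg⟩ := g.2
    exact mk_eq_mk.2 ⟨preimageOn K D g.1 hg ⊓ E, (hK.preimageOn hD hg).inf hE,
      fun x hx => by rw [← h' x hx.2, h _ hx.1.2]⟩)⟩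

theorem mk_add_mk {f g : N → N} {hf hg} :
    (mk f hf + mk g hg : LocalizedEnd G N) = mk (fun x => f x + g x) (add_aux hf hg) := rfl

theorem mk_mul_mk [G.IsGabriel] {f g : N → N} {hf hg} :
    (mk f hf * mk g hg : LocalizedEnd G N) = mk (fun x => f (g x)) (mul_aux hf hg) := rfl

theorem mk_congr {f g : N → N} {hf hg} (h : ∀ x, f x = g x) :
    (mk f hf : LocalizedEnd G N) = mk g hg :=
  mk_eq_mk.2 ⟨⊤, .top, fun x _ => h x⟩

instance [G.IsGabriel] : Ring (LocalizedEnd G N) where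
  add_assoc a b c := by
    induction a using ind; induction b using ind; induction c using ind
    exact mk_congr fun x => add_assoc _ _ _
  zero_add a := by
    induction a using ind
    exact mk_congr fun x => zero_add _
  add_zero a := by
    induction a using ind
    exact mk_congr fun x => add_zero _
  add_comm a b := by
    induction a using ind; induction b using ind
    exact mk_congr fun x => add_comm _ _
  neg_add_cancel a := by
    induction a using ind
    exact mk_congr fun x => neg_add_cancel _
  mul_assoc a b c := by
    induction a using ind; induction b using ind; induction c using ind
    rfl
  one_mul a := by
    induction a using ind
    exact mk_congr fun x => rfl
  mul_one a := by
    induction a using ind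
    exact mk_congr fun x => rfl
  zero_mul a := by
    induction a using ind
    exact mk_congr fun x => rfl
  mul_zero a := by
    induction a using ind with | _ f hf
    obtain ⟨D, hD, h⟩ := hf
    exact mk_congr fun x => by simpa using h.2 0 0 D.zero_mem
  left_distrib a b c := by
    induction a using ind with | _ f hf
    induction b using ind with | _ g hg
    induction c using ind with | _ k hk
    obtain ⟨D, hD, hf'⟩ := id hf
    obtain ⟨E, hE, hg'⟩ := id hg
    obtain ⟨K, hK, hk'⟩ := id hk
    exact mk_eq_mk.2 ⟨preimageOn E D g hg' ⊓ preimageOn K D k hk',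
      (hE.preimageOn hD hg').inf (hK.preimageOn hD hk'),
      fun x hx => hf'.1 _ hx.1.2 _ hx.2.2⟩
  right_distrib a b c := by
    induction a using ind; induction b using ind; induction c using ind
    rfl
  nsmul := nsmulRec
  zsmul := zsmulRec

end LocalizedEnd

end LocalizedEnd

section GClosed

variable {R : Type u} [Ring R] (G : IdealFilter Rᵐᵒᵖ)

/-- A right `R`-module `C` is `G`-closed if `Hom_R(R, C) → Hom_R(I, C)` is bijective for all
`I ∈ G`. -/
def IsGClosed (C : Type v) [AddCommGroup C] [Module Rᵐᵒᵖ C] : Prop :=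
  ∀ I ∈ G, Function.Bijective fun g : Rᵐᵒᵖ →ₗ[Rᵐᵒᵖ] C => g.domRestrict I

variable {G}

theorem IsGClosed.eq_zero {C : Type v} [AddCommGroup C] [Module Rᵐᵒᵖ C] (hC : IsGClosed G C)
    {I : Ideal Rᵐᵒᵖ} (hI : I ∈ G) {c : C} (h : ∀ a ∈ I, a • c = 0) : c = 0 := by
  have : LinearMap.toSpanSingleton Rᵐᵒᵖ C c = 0 := by
    apply (hC I hI).1
    ext a
    simpa using h a a.2
  simpa using congrArg (fun g => g 1) this

variable (G) in
/-- A left `R`-module `X` is `G`-divisible if `I X = X` for all `I ∈ G`. -/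
def IsGDivisible (X : Type v) [AddCommGroup X] [Module R X] : Prop :=
  ∀ I ∈ G, AddSubgroup.closure {y : X | ∃ a ∈ I, ∃ x : X, y = unop a • x} = ⊤

end GClosed

section QuotientRing

variable {R : Type u} [Ring R] (G : IdealFilter Rᵐᵒᵖ) [G.IsGabriel]

/-- The right module `R / t(R)`, where `t(R)` is the `G`-torsion submodule of `R`. -/
abbrev TorsionFreeQuotient : Type u := Rᵐᵒᵖ ⧸ torsionSubmodule G Rᵐᵒᵖ

/-- The ring of quotients `Q_G`: the direct limit of `Hom_R(I, R / t(R))` over `I ∈ G`, or,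
equivalently, of `Hom_R(D, R / t(R))` over the dense submodules `D` of `R / t(R)`. -/
abbrev QuotientRing : Type u := LocalizedEnd G (TorsionFreeQuotient G)

/-- The right `R`-linear endomorphism of `R / t(R)` induced by `x ↦ r x`. -/
def leftMul (r : R) : TorsionFreeQuotient G →ₗ[Rᵐᵒᵖ] TorsionFreeQuotient G :=
  Submodule.mapQ _ _ (LinearMap.toSpanSingleton Rᵐᵒᵖ Rᵐᵒᵖ (op r)) (by
    rintro x ⟨L, hL, h⟩
    refine ⟨L, hL, fun a ha => ?_⟩
    have := h a ha
    simp only [LinearMap.toSpanSingleton_apply, smul_eq_mul] at this ⊢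
    rw [← mul_assoc, this, zero_mul])

theorem leftMul_mk (r : R) (x : Rᵐᵒᵖ) :
    leftMul G r (Submodule.Quotient.mk x) = Submodule.Quotient.mk (x * op r) := rfl

/-- The canonical ring homomorphism `λ_G : R → Q_G`. -/
def toQuotientRing : R →+* QuotientRing G where
  toFun r := LocalizedEnd.ofEnd (leftMul G r)
  map_one' := LocalizedEnd.mk_congr fun x => by
    obtain ⟨x, rfl⟩ := Submodule.Quotient.mk_surjective _ x
    rw [leftMul_mk, op_one, mul_one]; rfl
  map_mul' r s := LocalizedEnd.mk_congr fun x => by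
    obtain ⟨x, rfl⟩ := Submodule.Quotient.mk_surjective _ x
    change _ = leftMul G r (leftMul G s _)
    rw [leftMul_mk, leftMul_mk, leftMul_mk, op_mul, mul_assoc]
  map_zero' := LocalizedEnd.mk_congr fun x => by
    obtain ⟨x, rfl⟩ := Submodule.Quotient.mk_surjective _ x
    rw [leftMul_mk, op_zero, mul_zero]; rfl
  map_add' r s := LocalizedEnd.mk_congr fun x => by
    obtain ⟨x, rfl⟩ := Submodule.Quotient.mk_surjective _ x
    change _ = leftMul G r _ + leftMul G s _
    rw [leftMul_mk, leftMul_mk, leftMul_mk, op_add, mul_add]; rfl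

/-- `Q_G` as a left `R`-module through `λ_G`. -/
instance : Module R (QuotientRing G) := Module.compHom _ (toQuotientRing G)

/-- `Q_G` as a right `R`-module through `λ_G`. -/
instance : Module Rᵐᵒᵖ (QuotientRing G) :=
  Module.compHom _ (toQuotientRing G).op

variable {G}

theorem torsionFreeQuotient_eq_zero {I : Ideal Rᵐᵒᵖ} (hI : I ∈ G) {n : TorsionFreeQuotient G}
    (h : ∀ a ∈ I, a • n = 0) : n = 0 := by
  obtain ⟨s, rfl⟩ := Submodule.Quotient.mk_surjective _ n
  rw [Submodule.Quotient.mk_eq_zero]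
  refine ⟨(⊥ : Ideal Rᵐᵒᵖ).colon {s}, IdealFilter.IsGabriel.gabriel_closed _ ⟨I, hI, ?_⟩, ?_⟩
  · intro a ha
    have := h a ha
    rw [← Submodule.Quotient.mk_smul, Submodule.Quotient.mk_eq_zero] at this
    obtain ⟨L, hL, h'⟩ := this
    refine Order.PFilter.mem_of_le (fun b hb => ?_) hL
    rw [Submodule.mem_colon_singleton, Submodule.mem_colon_singleton, smul_assoc]
    exact h' b hb
  · intro a ha
    simpa [Submodule.mem_colon_singleton] using ha

theorem toQuotientRing_eq_zero {s : Rᵐᵒᵖ} (h : toQuotientRing G (unop s) = 0) :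
    (Submodule.Quotient.mk s : TorsionFreeQuotient G) = 0 := by
  obtain ⟨D, hD, h⟩ := LocalizedEnd.mk_eq_mk.1 h
  refine torsionFreeQuotient_eq_zero (hD (Submodule.Quotient.mk 1)) fun a ha => ?_
  rw [Submodule.mem_colon_singleton] at ha
  have := h _ ha
  rw [← Submodule.Quotient.mk_smul, leftMul_mk, smul_eq_mul, mul_one, ← smul_eq_mul,
    op_unop, Submodule.Quotient.mk_smul] at this
  exact this

theorem smul_mk {f : TorsionFreeQuotient G → TorsionFreeQuotient G}
    {D : Submodule Rᵐᵒᵖ (TorsionFreeQuotient G)} (hD : IsDense G D) (hf : IsLinearOn D f)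
    {a s : Rᵐᵒᵖ} (ha : Submodule.Quotient.mk a ∈ D)
    (hs : f (Submodule.Quotient.mk a) = Submodule.Quotient.mk s) :
    a • (LocalizedEnd.mk f ⟨D, hD, hf⟩ : QuotientRing G) = toQuotientRing G (unop s) := by
  refine LocalizedEnd.mk_congr fun x => ?_
  obtain ⟨x, rfl⟩ := Submodule.Quotient.mk_surjective _ x
  change f (leftMul G (unop a) _) = leftMul G (unop s) _
  rw [leftMul_mk, leftMul_mk, op_unop, op_unop, ← smul_eq_mul, Submodule.Quotient.mk_smul,
    hf.2 _ _ ha, hs]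
  rfl

theorem smul_toQuotientRing (a s : Rᵐᵒᵖ) :
    a • toQuotientRing G (unop s) = toQuotientRing G (unop (a * s)) :=
  (map_mul (toQuotientRing G) (unop s) (unop a)).symm

theorem exists_smul_eq (q : QuotientRing G) :
    ∃ J ∈ G, ∀ a ∈ J, ∃ s : Rᵐᵒᵖ, a • q = toQuotientRing G (unop s) := by
  induction q using LocalizedEnd.ind with | _ f hf
  obtain ⟨D, hD, hf⟩ := hf
  refine ⟨_, hD (Submodule.Quotient.mk 1), fun a ha => ?_⟩
  rw [Submodule.mem_colon_singleton, ← Submodule.Quotient.mk_smul, smul_eq_mul, mul_one] at ha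
  obtain ⟨s, hs⟩ := Submodule.Quotient.mk_surjective _ (f (Submodule.Quotient.mk a))
  exact ⟨s, smul_mk hD hf ha hs.symm⟩

theorem quotientRing_eq_zero {I : Ideal Rᵐᵒᵖ} (hI : I ∈ G) {q : QuotientRing G}
    (h : ∀ a ∈ I, a • q = 0) : q = 0 := by
  induction q using LocalizedEnd.ind with | _ f hf
  obtain ⟨D, hD, hf⟩ := hf
  let J := I ⊓ D.colon {Submodule.Quotient.mk 1}
  have hJ : J ∈ G := Order.PFilter.inf_mem hI (hD _)
  refine LocalizedEnd.mk_eq_mk.2 ⟨Submodule.map (Submodule.mkQ _) J, fun n => ?_, ?_⟩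
  · obtain ⟨x, rfl⟩ := Submodule.Quotient.mk_surjective _ n
    refine Order.PFilter.mem_of_le (fun b hb => ?_) (IdealFilter.IsUniform.colon_mem hJ x)
    rw [Submodule.mem_colon_singleton] at hb ⊢
    exact ⟨_, hb, rfl⟩
  · rintro _ ⟨a, ⟨haI, haD⟩, rfl⟩
    rw [SetLike.mem_coe, Submodule.mem_colon_singleton, ← Submodule.Quotient.mk_smul,
      smul_eq_mul, mul_one] at haD
    obtain ⟨s, hs⟩ := Submodule.Quotient.mk_surjective _ (f (Submodule.Quotient.mk a))
    have h1 := smul_mk hD hf haD hs.symm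
    rw [h a haI] at h1
    exact hs.symm.trans (toQuotientRing_eq_zero h1.symm)

variable (G) in
/-- `Q_G` is a `G`-closed right `R`-module. -/
theorem isGClosed_quotientRing : IsGClosed G (QuotientRing G) := by
  classical
  intro I hI
  constructor
  · intro g g' h
    ext
    rw [← sub_eq_zero]
    refine quotientRing_eq_zero hI fun a ha => ?_
    have := LinearMap.congr_fun h ⟨a, ha⟩
    simp only [LinearMap.domRestrict_apply] at this
    rw [smul_sub, ← map_smul, ← map_smul, smul_eq_mul, mul_one, this, sub_self]
  intro h
  let D : Submodule Rᵐᵒᵖ (TorsionFreeQuotient G) :=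
    { carrier := {n | ∃ (x : I) (s : Rᵐᵒᵖ), (torsionSubmodule G Rᵐᵒᵖ).mkQ x = n ∧
        h x = toQuotientRing G (unop s)}
      add_mem' := by
        rintro _ _ ⟨x, s, rfl, hx⟩ ⟨y, t, rfl, hy⟩
        exact ⟨x + y, s + t, rfl, by rw [map_add, hx, hy, unop_add, map_add]⟩
      zero_mem' := ⟨0, 0, rfl, by simp⟩
      smul_mem' := by
        rintro a _ ⟨x, s, rfl, hx⟩
        exact ⟨a • x, a * s, rfl, by rw [map_smul, hx, smul_toQuotientRing]⟩ }
  have key : ∀ (x y : I) (s t : Rᵐᵒᵖ),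
      (torsionSubmodule G Rᵐᵒᵖ).mkQ x = (torsionSubmodule G Rᵐᵒᵖ).mkQ y →
      h x = toQuotientRing G (unop s) → h y = toQuotientRing G (unop t) →
      (Submodule.Quotient.mk s : TorsionFreeQuotient G) = Submodule.Quotient.mk t := by
    intro x y s t hxy hx hy
    rw [Submodule.mkQ_apply, Submodule.mkQ_apply, Submodule.Quotient.eq] at hxy
    obtain ⟨L, hL, h'⟩ := hxy
    have h0 : h (x - y) = 0 := quotientRing_eq_zero hL fun a ha => by
      rw [← map_smul, (Subtype.ext (h' a ha) : a • (x - y) = 0), map_zero]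
    rw [← sub_eq_zero, ← Submodule.Quotient.mk_sub]
    apply toQuotientRing_eq_zero
    rw [unop_sub, map_sub, ← hx, ← hy, ← map_sub, h0]
  let f : TorsionFreeQuotient G → TorsionFreeQuotient G := fun n =>
    if hn : n ∈ D then Submodule.Quotient.mk hn.choose_spec.choose else 0
  have hf : ∀ (x : I) (s : Rᵐᵒᵖ), h x = toQuotientRing G (unop s) →
      f ((torsionSubmodule G Rᵐᵒᵖ).mkQ x) = Submodule.Quotient.mk s := by
    intro x s hx
    have hn : (torsionSubmodule G Rᵐᵒᵖ).mkQ x ∈ D := ⟨x, s, rfl, hx⟩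
    simp only [f, dif_pos hn]
    exact key _ x _ _ hn.choose_spec.choose_spec.1 hn.choose_spec.choose_spec.2 hx
  have hlin : IsLinearOn D f := by
    constructor
    · rintro _ ⟨x, s, rfl, hx⟩ _ ⟨y, t, rfl, hy⟩
      rw [hf x s hx, hf y t hy]
      exact hf (x + y) (s + t) (by rw [map_add, hx, hy, unop_add, map_add])
    · rintro a _ ⟨x, s, rfl, hx⟩
      rw [hf x s hx]
      exact hf (a • x) (a * s) (by rw [map_smul, hx, smul_toQuotientRing])
  have hD : IsDense G D := by
    intro n
    obtain ⟨y, rfl⟩ := Submodule.Quotient.mk_surjective _ n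
    refine IdealFilter.IsGabriel.gabriel_closed _
      ⟨I.colon {y}, IdealFilter.IsUniform.colon_mem hI y, fun a ha => ?_⟩
    rw [Submodule.mem_colon_singleton] at ha
    obtain ⟨J, hJ, hs⟩ := exists_smul_eq (h ⟨a • y, ha⟩)
    refine Order.PFilter.mem_of_le (fun b hb => ?_) hJ
    rw [Submodule.mem_colon_singleton, Submodule.mem_colon_singleton, smul_assoc]
    obtain ⟨s, hs⟩ := hs b hb
    exact ⟨b • ⟨a • y, ha⟩, s, rfl, by rw [map_smul, hs]⟩
  refine ⟨LinearMap.toSpanSingleton _ _ (LocalizedEnd.mk f ⟨D, hD, hlin⟩), ?_⟩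
  ext x
  rw [LinearMap.domRestrict_apply, LinearMap.toSpanSingleton_apply, ← sub_eq_zero]
  obtain ⟨J, hJ, hs⟩ := exists_smul_eq (h x)
  refine quotientRing_eq_zero hJ fun b hb => ?_
  obtain ⟨s, hs⟩ := hs b hb
  have hbx : h (b • x) = toQuotientRing G (unop s) := by rw [map_smul, hs]
  rw [smul_sub, hs, sub_eq_zero, ← smul_assoc]
  exact smul_mk hD hlin ⟨b • x, s, rfl, hbx⟩ (hf _ s hbx)

variable (G) in
/-- `λ_G : R → Q_G` is the reflection of the right module `R` in the `G`-closed modules. -/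
theorem existsUnique_extension {C : Type v} [AddCommGroup C] [Module Rᵐᵒᵖ C]
    (hC : IsGClosed G C) (g : R →ₗ[Rᵐᵒᵖ] C) :
    ∃! h : QuotientRing G →ₗ[Rᵐᵒᵖ] C, ∀ r, h (toQuotientRing G r) = g r := by
  have hg : ∀ a s : Rᵐᵒᵖ, a • g (unop s) = g (unop (a * s)) := fun a s =>
    (map_smul g a (unop s)).symm
  have hker : ∀ s : Rᵐᵒᵖ, toQuotientRing G (unop s) = 0 → g (unop s) = 0 := by
    intro s hs
    have := toQuotientRing_eq_zero hs
    rw [Submodule.Quotient.mk_eq_zero] at this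
    obtain ⟨L, hL, h⟩ := this
    refine hC.eq_zero hL fun a ha => ?_
    rw [hg, ← smul_eq_mul, h a ha, unop_zero, map_zero]
  let H : QuotientRing G → C → Prop := fun q c =>
    ∃ J ∈ G, ∀ a ∈ J, ∃ s : Rᵐᵒᵖ, a • q = toQuotientRing G (unop s) ∧ a • c = g (unop s)
  have huniq : ∀ q c c', H q c → H q c' → c = c' := by
    rintro q c c' ⟨J, hJ, h⟩ ⟨J', hJ', h'⟩
    rw [← sub_eq_zero]
    refine hC.eq_zero (Order.PFilter.inf_mem hJ hJ') fun a ha => ?_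
    obtain ⟨s, hs, hs'⟩ := h a ha.1
    obtain ⟨t, ht, ht'⟩ := h' a ha.2
    rw [smul_sub, hs', ht', ← map_sub, ← unop_sub]
    apply hker
    rw [unop_sub, map_sub, ← hs, ← ht, sub_self]
  have hex : ∀ q, ∃ c, H q c := by
    intro q
    obtain ⟨J, hJ, hs⟩ := exists_smul_eq q
    choose s hs using hs
    have hwd : ∀ t t' : Rᵐᵒᵖ, toQuotientRing G (unop t) = toQuotientRing G (unop t') →
        g (unop t) = g (unop t') := by
      intro t t' h
      rw [← sub_eq_zero, ← map_sub, ← unop_sub]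
      apply hker
      rw [unop_sub, map_sub, h, sub_self]
    let k : J →ₗ[Rᵐᵒᵖ] C :=
      { toFun := fun a => g (unop (s a a.2))
        map_add' := fun a b => by
          rw [← map_add, ← unop_add]
          apply hwd
          rw [← hs, unop_add, map_add, ← hs, ← hs]
          exact add_smul _ _ _
        map_smul' := fun a b => by
          rw [RingHom.id_apply, hg]
          apply hwd
          rw [← hs, ← smul_toQuotientRing, ← hs]
          exact mul_smul _ _ _ }
    obtain ⟨l, hl⟩ := (hC J hJ).2 k
    refine ⟨l 1, J, hJ, fun a ha => ⟨s a ha, hs a ha, ?_⟩⟩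
    have := LinearMap.congr_fun hl ⟨a, ha⟩
    rw [← map_smul, smul_eq_mul, mul_one]
    exact this
  choose h hh using hex
  refine ⟨{ toFun := h, map_add' := fun q q' => ?_, map_smul' := fun r q => ?_ }, ?_, ?_⟩
  · refine huniq _ _ _ (hh _) ?_
    obtain ⟨J, hJ, h1⟩ := hh q
    obtain ⟨J', hJ', h2⟩ := hh q'
    refine ⟨J ⊓ J', Order.PFilter.inf_mem hJ hJ', fun a ha => ?_⟩
    obtain ⟨s, hs, hs'⟩ := h1 a ha.1
    obtain ⟨t, ht, ht'⟩ := h2 a ha.2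
    exact ⟨s + t, by rw [smul_add, hs, ht, unop_add, map_add],
      by rw [smul_add, hs', ht', unop_add, map_add]⟩
  · refine huniq _ _ _ (hh _) ?_
    obtain ⟨J, hJ, h1⟩ := hh q
    refine ⟨J.colon {r}, IdealFilter.IsUniform.colon_mem hJ r, fun a ha => ?_⟩
    rw [Submodule.mem_colon_singleton] at ha
    obtain ⟨s, hs, hs'⟩ := h1 _ ha
    exact ⟨s, by rw [← hs, smul_assoc], by rw [← hs', RingHom.id_apply, smul_assoc]⟩
  · intro r
    obtain ⟨J, hJ⟩ := G.nonempty
    exact huniq _ _ _ (hh _) ⟨J, hJ, fun a _ => ⟨a * op r, smul_toQuotientRing a (op r),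
      hg a (op r)⟩⟩
  · intro h' hh'
    ext q
    refine huniq _ _ _ ?_ (hh q)
    obtain ⟨J, hJ, hs⟩ := exists_smul_eq q
    refine ⟨J, hJ, fun a ha => ?_⟩
    obtain ⟨s, hs⟩ := hs a ha
    exact ⟨s, hs, by rw [← map_smul, hs, hh']⟩

variable (G) in
/-- `G` is perfect if the left `R`-module `Q_G` is `G`-divisible. -/
def IsPerfect : Prop := IsGDivisible G (QuotientRing G)

end QuotientRing

section TorsionPair

variable {R : Type u} [Ring R]

/-- `(T, F)` is a hereditary torsion pair of right `R`-modules. -/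
structure IsHereditaryTorsionPair (T F : CategoryTheory.ObjectProperty (ModuleCat.{u} Rᵐᵒᵖ)) :
    Prop where
  torsion_iff : ∀ M, T M ↔ ∀ N, F N → ∀ f : M →ₗ[Rᵐᵒᵖ] N, f = 0
  torsionFree_iff : ∀ N, F N ↔ ∀ M, T M → ∀ f : M →ₗ[Rᵐᵒᵖ] N, f = 0
  submodule : ∀ M, T M → ∀ K : Submodule Rᵐᵒᵖ M, T (ModuleCat.of Rᵐᵒᵖ K)

/-- The torsion class `T` corresponds to `G`: `G` consists of the right ideals `I` of `R` with
`R / I ∈ T`. -/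
def CorrespondsTo (G : IdealFilter Rᵐᵒᵖ) (T : CategoryTheory.ObjectProperty (ModuleCat.{u} Rᵐᵒᵖ)) :
    Prop :=
  ∀ I : Ideal Rᵐᵒᵖ, I ∈ G ↔ T (ModuleCat.of Rᵐᵒᵖ (Rᵐᵒᵖ ⧸ I))

/-- The class of all finitely presented modules in `T`. -/
def finitelyPresentedIn (T : CategoryTheory.ObjectProperty (ModuleCat.{u} Rᵐᵒᵖ)) :
    CategoryTheory.ObjectProperty (ModuleCat.{u} Rᵐᵒᵖ) :=
  fun M => T M ∧ Module.FinitePresentation Rᵐᵒᵖ M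

variable (R) in
/-- Every finitely generated right ideal of `R` is projective. -/
def IsRightSemihereditary : Prop :=
  ∀ I : Ideal Rᵐᵒᵖ, I.FG → Module.Projective Rᵐᵒᵖ I

end TorsionPair

section UniversalLocalization

variable {R S : Type u} [Ring R] [Ring S] (lam : R →+* S)

/-- The right `S`-submodule of `S ⊗_ℤ P` generated by the elements
`(λ(r) s) ⊗ p - s ⊗ (p r)`. -/
def balancingSubmodule (P : Type u) [AddCommGroup P] [Module Rᵐᵒᵖ P] :
    Submodule Sᵐᵒᵖ (S ⊗[ℤ] P) :=
  Submodule.span Sᵐᵒᵖ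
    {t | ∃ (s : S) (r : R) (p : P), t = (lam r * s) ⊗ₜ[ℤ] p - s ⊗ₜ[ℤ] (op r • p)}

/-- The right `S`-module `P ⊗_R S`, for a right `R`-module `P` and a ring homomorphism
`λ : R → S`.  The element `p ⊗ s` is the class of `s ⊗ₜ[ℤ] p`. -/
abbrev BaseChange (P : Type u) [AddCommGroup P] [Module Rᵐᵒᵖ P] : Type u :=
  (S ⊗[ℤ] P) ⧸ balancingSubmodule lam P

/-- The right `S`-linear map `α ⊗_R S : P ⊗_R S → Q ⊗_R S`. -/
def baseChangeMap {P Q : Type u} [AddCommGroup P] [Module Rᵐᵒᵖ P] [AddCommGroup Q]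
    [Module Rᵐᵒᵖ Q] (α : P →ₗ[Rᵐᵒᵖ] Q) : BaseChange lam P →ₗ[Sᵐᵒᵖ] BaseChange lam Q :=
  Submodule.mapQ _ _
    (TensorProduct.AlgebraTensorModule.lTensor Sᵐᵒᵖ S α.toAddMonoidHom.toIntLinearMap) (by
      rw [balancingSubmodule, Submodule.span_le]
      rintro _ ⟨s, r, p, rfl⟩
      refine Submodule.subset_span ⟨s, r, α p, ?_⟩
      simp)

/-- `λ` inverts all morphisms in `W`. -/
def IsInverting (W : CategoryTheory.MorphismProperty (ModuleCat.{u} Rᵐᵒᵖ)) : Prop :=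
  ∀ ⦃P Q : ModuleCat.{u} Rᵐᵒᵖ⦄ (α : P ⟶ Q), W α → Function.Bijective (baseChangeMap lam α.hom)

/-- `λ` is a universal localization of `R` at the class `W` of morphisms. -/
def IsUniversalLocalization (W : CategoryTheory.MorphismProperty (ModuleCat.{u} Rᵐᵒᵖ)) : Prop :=
  IsInverting lam W ∧ ∀ (T : Type u) [Ring T] (ψ : R →+* T), IsInverting ψ W →
    ∃! φ : S →+* T, φ.comp lam = ψ

/-- `W` consists of monomorphisms `α : P → Q` between finitely generated projective right
`R`-modules which have a cokernel in `C`, and every `U ∈ C` has a resolution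
`0 → P → Q → U → 0` with `P → Q` in `W`. -/
structure IsResolvingFor (W : CategoryTheory.MorphismProperty (ModuleCat.{u} Rᵐᵒᵖ))
    (C : CategoryTheory.ObjectProperty (ModuleCat.{u} Rᵐᵒᵖ)) : Prop where
  of_mem : ∀ ⦃P Q : ModuleCat.{u} Rᵐᵒᵖ⦄ (α : P ⟶ Q), W α →
    (Module.Finite Rᵐᵒᵖ P ∧ Module.Projective Rᵐᵒᵖ P) ∧
    (Module.Finite Rᵐᵒᵖ Q ∧ Module.Projective Rᵐᵒᵖ Q) ∧
    Function.Injective α.hom ∧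
    ∃ U, C U ∧ ∃ β : Q ⟶ U, Function.Surjective β.hom ∧ Function.Exact α.hom β.hom
  exists_resolution : ∀ U, C U → ∃ (P Q : ModuleCat.{u} Rᵐᵒᵖ) (α : P ⟶ Q) (β : Q ⟶ U),
    W α ∧ Function.Surjective β.hom ∧ Function.Exact α.hom β.hom

/-- `λ` is a universal localization of `R` at the class `C` of right modules, that is, at a class
of morphisms formed by projective resolutions `0 → P → Q → U → 0` of the modules `U ∈ C`. -/
def IsUniversalLocalizationAt (C : CategoryTheory.ObjectProperty (ModuleCat.{u} Rᵐᵒᵖ)) : Prop :=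
  ∃ W, IsResolvingFor W C ∧ IsUniversalLocalization lam W

/-- `λ : R → S` is an epimorphism in the category of rings. -/
def IsRingEpimorphism : Prop := CategoryTheory.Epi (RingCat.ofHom lam)

/-- `λ : R → S` and `λ' : R → S'` are equivalent: `λ' = φ λ` for a ring isomorphism `φ`. -/
def AreEquivalent {S' : Type u} [Ring S'] (lam' : R →+* S') : Prop :=
  ∃ φ : S ≃+* S', lam' = φ.toRingHom.comp lam

end UniversalLocalization

end PerfectLocalization

/-! Everything is tested on maps into `S` through the adjunction `Hom_R(P, S) ≅ Hom_S(P ⊗_R S, S)`.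
Perfectness is used as the identity `1 = ∑ λ(aᵢ) qᵢ` in `Q_G`, with the `aᵢ` in a prescribed `I ∈ G`
(`IsPerfect.exists_sum_eq_one`). It makes `λ_G` an epimorphism, makes `α ⊗ Q_G` surjective when `α`
has torsion cokernel, and shows that the finitely generated members of `G` are cofinal
(`IsPerfect.exists_fg_le`).

Let `W` be any class of resolutions of the finitely presented torsion modules. Since `Q_G` is
`G`-closed, maps `P → Q_G` extend along each `α : P → N` in `W`; applied to the coordinates of a
dual basis of `P`, this makes `α ⊗ Q_G` injective. So `λ_G` inverts `W`.

Conversely, let `ψ : R → S` invert `W`. For finitely generated `I ∈ G` the module `R/I` is finitely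
presented and torsion, and inverting its resolution amounts to `Hom(R/I, S) = Ext¹(R/I, S) = 0`. By
cofinality `S` is `G`-closed (`IsPerfect.isGClosed_of_isInverting`), so the reflection property of
`Q_G` extends `ψ` uniquely to `Q_G`. Semiheredity provides a class `W` to begin with. -/

namespace PerfectLocalization

/-! ### Base change and the adjunction with maps into `S` -/

namespace BaseChange

variable {R S : Type u} [Ring R] [Ring S] (lam : R →+* S)
  {P : Type u} [AddCommGroup P] [Module Rᵐᵒᵖ P] {N : Type u} [AddCommGroup N] [Module Rᵐᵒᵖ N]

/-- The element `p ⊗ s` of `P ⊗_R S`. -/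
def tmul (s : S) (p : P) : BaseChange lam P := Submodule.Quotient.mk (s ⊗ₜ[ℤ] p)

variable {lam}

theorem add_tmul (s s' : S) (p : P) : tmul lam (s + s') p = tmul lam s p + tmul lam s' p := by
  simp [tmul, TensorProduct.add_tmul]

theorem tmul_add (s : S) (p p' : P) : tmul lam s (p + p') = tmul lam s p + tmul lam s p' := by
  simp [tmul, TensorProduct.tmul_add]

theorem zero_tmul (p : P) : tmul lam 0 p = 0 := by
  simp [tmul]

theorem smul_tmul (t s : S) (p : P) : op t • tmul lam s p = tmul lam (s * t) p := rfl

theorem tmul_sum {ι : Type*} (I : Finset ι) (s : S) (p : ι → P) :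
    tmul lam s (∑ i ∈ I, p i) = ∑ i ∈ I, tmul lam s (p i) :=
  map_sum (AddMonoidHom.mk' (tmul lam s) (tmul_add s) : P →+ BaseChange lam P) p I

theorem sum_tmul {ι : Type*} (I : Finset ι) (s : ι → S) (p : P) :
    tmul lam (∑ i ∈ I, s i) p = ∑ i ∈ I, tmul lam (s i) p :=
  map_sum (AddMonoidHom.mk' (fun s => tmul lam s p) (fun s s' => add_tmul s s' p) :
    S →+ BaseChange lam P) s I

theorem mul_tmul (r : R) (s : S) (p : P) : tmul lam (lam r * s) p = tmul lam s (op r • p) :=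
  (Submodule.Quotient.eq _).2 (Submodule.subset_span ⟨s, r, p, rfl⟩)

@[elab_as_elim]
theorem induction {motive : BaseChange lam P → Prop} (zero : motive 0)
    (tmul : ∀ s p, motive (tmul lam s p)) (add : ∀ x y, motive x → motive y → motive (x + y))
    (x : BaseChange lam P) : motive x := by
  obtain ⟨t, rfl⟩ := Submodule.Quotient.mk_surjective _ x
  induction t with
  | zero => exact zero
  | tmul s p => exact tmul s p
  | add a b ha hb => exact add _ _ ha hb

theorem baseChangeMap_tmul (α : P →ₗ[Rᵐᵒᵖ] N) (s : S) (p : P) :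
    baseChangeMap lam α (tmul lam s p) = tmul lam s (α p) := rfl

/-- The right `S`-linear map `P ⊗_R S → S`, `p ⊗ s ↦ g(p) s`, induced by a right `R`-linear map
`g : P → S`. -/
def lift (g : P →+ S) (hg : ∀ (r : R) p, g (op r • p) = g p * lam r) :
    BaseChange lam P →ₗ[Sᵐᵒᵖ] S :=
  Submodule.liftQ _
    (TensorProduct.AlgebraTensorModule.lift
      { toFun := fun s => ((AddMonoidHom.mulRight s).comp g).toIntLinearMap
        map_add' := fun s s' => by ext p; simp [mul_add]
        map_smul' := fun t s => by ext p; simp [mul_assoc] }) (by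
    rw [balancingSubmodule, Submodule.span_le]
    rintro _ ⟨s, r, p, rfl⟩
    simp [hg, mul_assoc])

theorem lift_tmul (g : P →+ S) (hg : ∀ (r : R) p, g (op r • p) = g p * lam r) (s : S) (p : P) :
    lift g hg (tmul lam s p) = g p * s := rfl

/-- Naturality of the adjunction in the module: it translates properties of `α ⊗_R S` into
properties of restriction along `α`, and back. -/
theorem lift_baseChangeMap (α : P →ₗ[Rᵐᵒᵖ] N) (g : N →+ S)
    (hg : ∀ (r : R) p, g (op r • p) = g p * lam r) (g' : P →+ S)
    (hg' : ∀ (r : R) p, g' (op r • p) = g' p * lam r) (h : ∀ p, g (α p) = g' p)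
    (x : BaseChange lam P) : lift g hg (baseChangeMap lam α x) = lift g' hg' x := by
  induction x using induction with
  | zero => simp
  | tmul s p => rw [baseChangeMap_tmul, lift_tmul, lift_tmul, h]
  | add x y hx hy => simp only [map_add, hx, hy]

/-- A right `R`-linear map `N → S` vanishing on the image of `α` is zero if `α ⊗_R S` is
surjective. -/
theorem eq_zero_of_comp_eq_zero {α : P →ₗ[Rᵐᵒᵖ] N}
    (hα : Function.Surjective (baseChangeMap lam α)) {g : N →+ S}
    (hg : ∀ (r : R) p, g (op r • p) = g p * lam r) (h : ∀ p, g (α p) = 0) (n : N) : g n = 0 := by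
  -- `g n` is the value of `lift g` at `n ⊗ 1`. Pulling `n ⊗ 1` back to `x` makes it the value at
  -- `x` of the lift of `g ∘ α = 0`.
  obtain ⟨x, hx⟩ := hα (tmul lam 1 n)
  have h0 := lift_baseChangeMap α g hg 0 (by simp) (by simpa using h) x
  rw [hx, lift_tmul, mul_one] at h0
  rw [h0]
  clear hx h0
  induction x using induction with
  | zero => simp
  | tmul s p => simp [lift_tmul]
  | add x y hx hy => rw [map_add, hx, hy, add_zero]

/-- If `α ⊗_R S` is bijective, then right `R`-linear maps to `S` extend along `α`. -/
theorem exists_extension {α : P →ₗ[Rᵐᵒᵖ] N} (hα : Function.Bijective (baseChangeMap lam α))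
    (h : P →+ S) (hh : ∀ (r : R) p, h (op r • p) = h p * lam r) :
    ∃ g : N →+ S, (∀ (r : R) n, g (op r • n) = g n * lam r) ∧ ∀ p, g (α p) = h p := by
  -- The extension transports `n ⊗ 1` back through `α ⊗ S` and then applies the lift of `h`.
  let e := LinearEquiv.ofBijective _ hα
  refine ⟨AddMonoidHom.mk' (fun n => lift h hh (e.symm (tmul lam 1 n))) fun n n' => ?_,
    fun r n => ?_, fun p => ?_⟩
  · rw [tmul_add, map_add, map_add]
  · have : tmul lam 1 (op r • n) = op (lam r) • tmul lam 1 n := by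
      rw [← mul_tmul, smul_tmul, mul_one, one_mul]
    simp only [AddMonoidHom.mk'_apply, this, map_smul]
    rfl
  · have : e.symm (tmul lam 1 (α p)) = tmul lam 1 p := by
      rw [LinearEquiv.symm_apply_eq]
      rfl
    simp only [AddMonoidHom.mk'_apply, this, lift_tmul, mul_one]

end BaseChange

/-! ### Semihereditary rings -/

section Semihereditary

variable {A : Type u} [Ring A]

/-- Over a semihereditary ring, finitely generated modules that embed into a finitely generated
free module are projective. -/
theorem projective_of_injective (hA : ∀ I : Ideal A, I.FG → Module.Projective A I) (n : ℕ) :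
    ∀ (M : Type v) [AddCommGroup M] [Module A M] [Module.Finite A M] (f : M →ₗ[A] Fin n → A),
      Function.Injective f → Module.Projective A M := by
  induction n with
  | zero =>
    intro M _ _ _ f hf
    have : Subsingleton M := hf.subsingleton
    infer_instance
  | succ n ih =>
    intro M _ _ _ f hf
    -- The image of the first coordinate is a finitely generated ideal, hence projective, so `p`
    -- splits onto it. Its kernel embeds into `Aⁿ` by the other coordinates.
    let p : M →ₗ[A] A := LinearMap.proj 0 ∘ₗ f
    have hJ : Module.Projective A (LinearMap.range p) := hA _ (by
      rw [LinearMap.range_eq_map]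
      exact Module.Finite.fg_top.map p)
    obtain ⟨s, hs⟩ := p.rangeRestrict.exists_rightInverse_of_surjective p.range_rangeRestrict
    have hs' : ∀ j, p.rangeRestrict (s j) = j := LinearMap.congr_fun hs
    let K := LinearMap.ker p.rangeRestrict
    -- The splitting retracts `M` onto the kernel, which is therefore finitely generated, as the
    -- induction hypothesis requires.
    let t : M →ₗ[A] K := (LinearMap.id - s ∘ₗ p.rangeRestrict).codRestrict K fun m => by
      rw [LinearMap.mem_ker, LinearMap.sub_apply, map_sub, LinearMap.comp_apply, hs',
        LinearMap.id_apply, sub_self]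
    have ht : Function.Surjective t := fun k => ⟨k, Subtype.ext (by
      have := LinearMap.mem_ker.1 k.2
      simp [t, this])⟩
    have : Module.Finite A K := Module.Finite.of_surjective t ht
    have : Module.Projective A K := ih K
      (LinearMap.pi (fun i => LinearMap.proj i.succ ∘ₗ f) ∘ₗ K.subtype) (by
        rw [injective_iff_map_eq_zero]
        intro k hk
        have h0 : p k = 0 := congrArg Subtype.val (LinearMap.mem_ker.1 k.2)
        refine Subtype.ext (hf ?_)
        rw [ZeroMemClass.coe_zero, map_zero]
        funext i
        refine Fin.cases h0 (fun i => ?_) i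
        exact congrFun hk i)
    exact Module.Projective.of_split (t.prod p.rangeRestrict) (K.subtype.coprod s)
      (by ext m; simp [t])

end Semihereditary

end PerfectLocalization

namespace PerfectLocalization

variable {R : Type u} [Ring R]

/-! ### Torsion modules and their resolutions -/

section Torsion

variable {T F : CategoryTheory.ObjectProperty (ModuleCat.{u} Rᵐᵒᵖ)}

theorem IsHereditaryTorsionPair.of_surjective (hTF : IsHereditaryTorsionPair T F)
    {M N : Type u} [AddCommGroup M] [Module Rᵐᵒᵖ M] [AddCommGroup N] [Module Rᵐᵒᵖ N]
    (hM : T (ModuleCat.of Rᵐᵒᵖ M)) (f : M →ₗ[Rᵐᵒᵖ] N) (hf : Function.Surjective f) :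
    T (ModuleCat.of Rᵐᵒᵖ N) := by
  rw [hTF.torsion_iff]
  intro X hX g
  have h0 := (hTF.torsion_iff _).1 hM X hX (g ∘ₗ f)
  ext n
  obtain ⟨m, rfl⟩ := hf n
  exact LinearMap.congr_fun h0 m

/-- Annihilators of elements of modules in the torsion class belong to the Gabriel topology. -/
theorem IsHereditaryTorsionPair.ker_toSpanSingleton_mem (hTF : IsHereditaryTorsionPair T F)
    {G : IdealFilter Rᵐᵒᵖ} (hGT : CorrespondsTo G T) {U : ModuleCat.{u} Rᵐᵒᵖ} (hU : T U) (x : U) :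
    LinearMap.ker (LinearMap.toSpanSingleton Rᵐᵒᵖ U x) ∈ G := by
  let f := LinearMap.toSpanSingleton Rᵐᵒᵖ U x
  -- `R / ann(x)` is isomorphic to the submodule `xR` of `U`, which is torsion by heredity.
  exact (hGT _).2 (hTF.of_surjective (hTF.submodule U hU (LinearMap.range f))
    f.quotKerEquivRange.symm.toLinearMap f.quotKerEquivRange.symm.surjective)

/-- By exactness, an element of `R` carries `n` into the image of `α` as soon as it annihilates the
image of `n` in the torsion cokernel. -/
theorem IsResolvingFor.isDense_range (hTF : IsHereditaryTorsionPair T F)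
    {G : IdealFilter Rᵐᵒᵖ} (hGT : CorrespondsTo G T)
    {W : CategoryTheory.MorphismProperty (ModuleCat.{u} Rᵐᵒᵖ)}
    (hW : IsResolvingFor W (finitelyPresentedIn T)) {P N : ModuleCat.{u} Rᵐᵒᵖ} {α : P ⟶ N}
    (hα : W α) : IsDense G (LinearMap.range α.hom) := by
  obtain ⟨-, -, -, U, hU, β, hβ, hex⟩ := hW.of_mem α hα
  intro n
  refine Order.PFilter.mem_of_le (fun a ha => ?_)
    (hTF.ker_toSpanSingleton_mem hGT hU.1 (β.hom n))
  rw [Submodule.mem_colon_singleton]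
  refine (hex _).1 ?_
  simpa using ha

/-- Over a right semihereditary ring, the finitely presented modules of any class have
resolutions of length one by finitely generated projective modules. -/
theorem exists_isResolvingFor (hR : IsRightSemihereditary R)
    (T : CategoryTheory.ObjectProperty (ModuleCat.{u} Rᵐᵒᵖ)) :
    ∃ W, IsResolvingFor W (finitelyPresentedIn T) := by
  -- Take the largest candidate for `W`; only the existence of resolutions remains. The kernel of a
  -- finite free cover of `U` is finitely generated inside a free module, hence projective.
  refine ⟨fun P Q α => (Module.Finite Rᵐᵒᵖ P ∧ Module.Projective Rᵐᵒᵖ P) ∧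
    (Module.Finite Rᵐᵒᵖ Q ∧ Module.Projective Rᵐᵒᵖ Q) ∧ Function.Injective α.hom ∧
    ∃ U, finitelyPresentedIn T U ∧ ∃ β : Q ⟶ U, Function.Surjective β.hom ∧
      Function.Exact α.hom β.hom, fun P Q α h => h, fun U hU => ?_⟩
  obtain ⟨hUT, hfp⟩ := id hU
  obtain ⟨n, f, hf⟩ := Module.Finite.exists_fin' Rᵐᵒᵖ U
  have hker := Module.FinitePresentation.fg_ker f hf
  have : Module.Finite Rᵐᵒᵖ (LinearMap.ker f) := .of_fg hker
  have hex : Function.Exact (LinearMap.ker f).subtype f := f.exact_subtype_ker_map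
  exact ⟨ModuleCat.of _ (LinearMap.ker f), ModuleCat.of _ (Fin n → Rᵐᵒᵖ),
    ModuleCat.ofHom (LinearMap.ker f).subtype, ModuleCat.ofHom f,
    ⟨⟨this, projective_of_injective hR n _ _ (LinearMap.ker f).injective_subtype⟩,
      ⟨inferInstanceAs (Module.Finite Rᵐᵒᵖ (Fin n → Rᵐᵒᵖ)),
        inferInstanceAs (Module.Projective Rᵐᵒᵖ (Fin n → Rᵐᵒᵖ))⟩,
      (LinearMap.ker f).injective_subtype, U, hU, ModuleCat.ofHom f, hf, hex⟩, hf, hex⟩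

end Torsion

/-! ### Extending maps into closed modules -/

section Closed

variable {G : IdealFilter Rᵐᵒᵖ} [G.IsGabriel]

/-- Maps to a `G`-closed module extend along maps with dense image. -/
theorem IsGClosed.exists_extension {C : Type v} [AddCommGroup C] [Module Rᵐᵒᵖ C]
    (hC : IsGClosed G C) {P N : Type u} [AddCommGroup P] [Module Rᵐᵒᵖ P] [AddCommGroup N]
    [Module Rᵐᵒᵖ N] {α : P →ₗ[Rᵐᵒᵖ] N} (hα : Function.Injective α)
    (hd : IsDense G (LinearMap.range α)) (h : P →ₗ[Rᵐᵒᵖ] C) :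
    ∃ g : N →ₗ[Rᵐᵒᵖ] C, ∀ p, g (α p) = h p := by
  -- The value at `n` is pinned down by its multiples: `a • c` must be `h` of the preimage of `a •
  -- n`, for all `a` in some member of `G`. Closedness for `(range α : n)` produces such a `c`;
  -- uniqueness then gives linearity.
  have hex : ∀ n, ∃ c : C, ∃ J ∈ G, ∀ a ∈ J, ∀ p, α p = a • n → a • c = h p := by
    intro n
    let I := (LinearMap.range α).colon {n}
    let e := LinearEquiv.ofInjective α hα
    let k : I →ₗ[Rᵐᵒᵖ] LinearMap.range α :=
      ((LinearMap.toSpanSingleton Rᵐᵒᵖ N n) ∘ₗ I.subtype).codRestrict _ fun a =>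
        Submodule.mem_colon_singleton.1 a.2
    obtain ⟨l, hl⟩ := (hC I (hd n)).2 (h ∘ₗ e.symm.toLinearMap ∘ₗ k)
    refine ⟨l 1, I, hd n, fun a ha p hp => ?_⟩
    have h1 := LinearMap.congr_fun hl ⟨a, ha⟩
    have h2 : e.symm (k ⟨a, ha⟩) = p := by
      rw [LinearEquiv.symm_apply_eq]
      exact Subtype.ext hp.symm
    rw [← map_smul, smul_eq_mul, mul_one]
    exact h1.trans (congrArg h h2)
  have huniq : ∀ n (c c' : C), (∃ J ∈ G, ∀ a ∈ J, ∀ p, α p = a • n → a • c = h p) →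
      (∃ J ∈ G, ∀ a ∈ J, ∀ p, α p = a • n → a • c' = h p) → c = c' := by
    rintro n c c' ⟨J, hJ, h1⟩ ⟨J', hJ', h2⟩
    rw [← sub_eq_zero]
    -- The condition is vacuous for `a` with `a • n` outside the range of `α`, hence the
    -- intersection with the colon ideal.
    refine hC.eq_zero (Order.PFilter.inf_mem (hd n) (Order.PFilter.inf_mem hJ hJ')) ?_
    rintro a ⟨ha, haJ, haJ'⟩
    obtain ⟨p, hp⟩ := Submodule.mem_colon_singleton.1 ha
    rw [smul_sub, h1 a haJ p hp, h2 a haJ' p hp, sub_self]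
  choose g hg using hex
  refine ⟨{ toFun := g, map_add' := fun n n' => ?_, map_smul' := fun r n => ?_ }, fun p => ?_⟩
  · refine huniq _ _ _ (hg _) ?_
    obtain ⟨J, hJ, h1⟩ := hg n
    obtain ⟨J', hJ', h2⟩ := hg n'
    refine ⟨J ⊓ J' ⊓ (LinearMap.range α).colon {n},
      Order.PFilter.inf_mem (Order.PFilter.inf_mem hJ hJ') (hd n), ?_⟩
    rintro a ⟨⟨haJ, haJ'⟩, ha⟩ q hq
    obtain ⟨p, hp⟩ := Submodule.mem_colon_singleton.1 ha
    rw [smul_add, h1 a haJ p hp, h2 a haJ' (q - p) (by rw [map_sub, hp, hq, smul_add]; abel),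
      ← map_add, add_sub_cancel]
  · refine huniq _ _ _ (hg _) ?_
    obtain ⟨J, hJ, h1⟩ := hg n
    refine ⟨J.colon {r}, IdealFilter.IsUniform.colon_mem hJ r, fun a ha q hq => ?_⟩
    rw [Submodule.mem_colon_singleton] at ha
    rw [RingHom.id_apply, ← smul_assoc]
    exact h1 _ ha q (by rw [hq, smul_assoc])
  · obtain ⟨J, hJ⟩ := G.nonempty
    refine huniq _ _ _ (hg _) ⟨J, hJ, fun a _ q hq => ?_⟩
    rw [← map_smul] at hq ⊢
    rw [hα hq]

end Closed

/-! ### Consequences of perfectness -/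

section Perfect

variable {G : IdealFilter Rᵐᵒᵖ} [G.IsGabriel]

/-- If `G` is perfect, then `1 = ∑ λ(aᵢ) qᵢ` in `Q_G` with elements `aᵢ` of any given `I ∈ G`. -/
theorem IsPerfect.exists_sum_eq_one (hG : IsPerfect G) {I : Ideal Rᵐᵒᵖ} (hI : I ∈ G) :
    ∃ (n : ℕ) (a : Fin n → Rᵐᵒᵖ) (q : Fin n → QuotientRing G), (∀ i, a i ∈ I) ∧
      ∑ i, toQuotientRing G (unop (a i)) * q i = 1 := by
  suffices h : ∀ x : QuotientRing G, x ∈ AddSubgroup.closure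
      {y : QuotientRing G | ∃ a ∈ I, ∃ x : QuotientRing G, y = unop a • x} →
      ∃ (n : ℕ) (a : Fin n → Rᵐᵒᵖ) (q : Fin n → QuotientRing G), (∀ i, a i ∈ I) ∧
        ∑ i, toQuotientRing G (unop (a i)) * q i = x from
    h 1 (by rw [hG I hI]; trivial)
  intro x hx
  induction hx using AddSubgroup.closure_induction with
  | mem x hx =>
    obtain ⟨a, ha, q, rfl⟩ := hx
    exact ⟨1, fun _ => a, fun _ => q, fun _ => ha, by simp; rfl⟩
  | zero => exact ⟨0, Fin.elim0, Fin.elim0, fun i => i.elim0, by simp⟩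
  | add x y _ _ hx hy =>
    obtain ⟨n, a, q, ha, rfl⟩ := hx
    obtain ⟨m, b, r, hb, rfl⟩ := hy
    refine ⟨n + m, Fin.append a b, Fin.append q r, fun i => ?_, by simp [Fin.sum_univ_add]⟩
    refine Fin.addCases (fun i => ?_) (fun i => ?_) i
    · simpa using ha i
    · simpa using hb i
  | neg x _ hx =>
    obtain ⟨n, a, q, ha, rfl⟩ := hx
    exact ⟨n, a, fun i => -q i, ha, by simp⟩

/-- For finitely many elements of `Q_G`, there is `J ∈ G` multiplying all of them into `λ(R)`. -/
theorem exists_forall_smul_eq {n : ℕ} (q : Fin n → QuotientRing G) :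
    ∃ J ∈ G, ∀ a ∈ J, ∀ i, ∃ s : Rᵐᵒᵖ, q i * toQuotientRing G (unop a) =
      toQuotientRing G (unop s) := by
  induction n with
  | zero =>
    obtain ⟨J, hJ⟩ := G.nonempty
    exact ⟨J, hJ, fun _ _ i => i.elim0⟩
  | succ n ih =>
    obtain ⟨J, hJ, h⟩ := ih fun i => q i.succ
    obtain ⟨J', hJ', h'⟩ := exists_smul_eq (q 0)
    exact ⟨J ⊓ J', Order.PFilter.inf_mem hJ hJ', fun a ha =>
      Fin.cases (h' a ha.2) (h a ha.1)⟩

/-- If `G` is perfect, then every `I ∈ G` contains a finitely generated `I' ∈ G`. -/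
theorem IsPerfect.exists_fg_le (hG : IsPerfect G) {I : Ideal Rᵐᵒᵖ} (hI : I ∈ G) :
    ∃ I' ∈ G, I'.FG ∧ I' ≤ I := by
  obtain ⟨n, a, q, ha, h1⟩ := hG.exists_sum_eq_one hI
  obtain ⟨J, hJ, h⟩ := exists_forall_smul_eq q
  refine ⟨Ideal.span (Set.range a), ?_, Submodule.fg_span (Set.finite_range a), ?_⟩
  -- Choose `J` with `qᵢ λ(b) = λ(sᵢ)` for `b ∈ J`. Then `λ(b) = ∑ λ(aᵢ) qᵢ λ(b) = λ(∑ aᵢ sᵢ)`, so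
  -- `b` differs from an element of the span by a torsion element, and an annihilator of the latter
  -- carries `b` into the span.
  · refine IdealFilter.IsGabriel.gabriel_closed _ ⟨J, hJ, fun b hb => ?_⟩
    choose s hs using h b hb
    have h2 : toQuotientRing G (unop (b - ∑ i, s i * a i)) = 0 := by
      have : toQuotientRing G (unop b) =
          ∑ i, toQuotientRing G (unop (a i)) * (q i * toQuotientRing G (unop b)) := by
        simp only [← mul_assoc]
        rw [← Finset.sum_mul, h1, one_mul]
      rw [unop_sub, map_sub, this, Finset.unop_sum, map_sum, sub_eq_zero]
      refine Finset.sum_congr rfl fun i _ => ?_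
      rw [hs, unop_mul, map_mul]
    have h3 := toQuotientRing_eq_zero h2
    rw [Submodule.Quotient.mk_eq_zero] at h3
    obtain ⟨L, hL, h4⟩ := h3
    refine Order.PFilter.mem_of_le (fun c hc => ?_) hL
    have h5 := h4 c hc
    rw [Submodule.mem_colon_singleton]
    rw [smul_sub, sub_eq_zero] at h5
    rw [h5]
    exact Submodule.smul_mem _ _ (Submodule.sum_mem _ fun i _ =>
      Ideal.mul_mem_left _ _ (Ideal.subset_span ⟨i, rfl⟩))
  · rw [Ideal.span_le]
    rintro _ ⟨i, rfl⟩
    exact ha i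

/-- A zigzag: `x = ∑ (x λ(aᵢ)) qᵢ`, where both `λ(aᵢ)` and `x λ(aᵢ)` lie in `λ(R)`, on which `f` and
`g` agree. -/
theorem IsPerfect.isRingEpimorphism (hG : IsPerfect G) :
    IsRingEpimorphism (toQuotientRing G) := by
  refine ⟨fun {T} f g hfg => ?_⟩
  have h : ∀ r, f.hom (toQuotientRing G r) = g.hom (toQuotientRing G r) := fun r =>
    RingHom.congr_fun (congrArg RingCat.Hom.hom hfg) r
  ext x
  obtain ⟨J, hJ, hs⟩ := exists_smul_eq x
  obtain ⟨n, a, q, ha, h1⟩ := hG.exists_sum_eq_one hJ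
  have hx : ∀ i, f.hom (x * toQuotientRing G (unop (a i))) =
      g.hom (x * toQuotientRing G (unop (a i))) := by
    intro i
    obtain ⟨s, hs⟩ := hs (a i) (ha i)
    have : x * toQuotientRing G (unop (a i)) = toQuotientRing G (unop s) := hs
    rw [this, h]
  calc f.hom x = f.hom x * g.hom (∑ i, toQuotientRing G (unop (a i)) * q i) := by
        rw [h1, map_one, mul_one]
    _ = ∑ i, f.hom (x * toQuotientRing G (unop (a i))) * g.hom (q i) := by
        rw [map_sum, Finset.mul_sum]
        exact Finset.sum_congr rfl fun i _ => by rw [map_mul, map_mul, ← h, mul_assoc]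
    _ = g.hom x * g.hom (∑ i, toQuotientRing G (unop (a i)) * q i) := by
        rw [map_sum, Finset.mul_sum]
        exact Finset.sum_congr rfl fun i _ => by rw [hx, map_mul, map_mul, mul_assoc]
    _ = g.hom x := by rw [h1, map_one, mul_one]

/-- If `G` is perfect, then `α ⊗_R Q_G` is surjective whenever `α` has a torsion cokernel. -/
theorem IsPerfect.surjective_baseChangeMap (hG : IsPerfect G) {P N : Type u} [AddCommGroup P]
    [Module Rᵐᵒᵖ P] [AddCommGroup N] [Module Rᵐᵒᵖ N] {α : P →ₗ[Rᵐᵒᵖ] N}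
    (hd : IsDense G (LinearMap.range α)) :
    Function.Surjective (baseChangeMap (toQuotientRing G) α) := by
  intro x
  induction x using BaseChange.induction with
  | zero => exact ⟨0, map_zero _⟩
  | tmul s n =>
    -- With `n aᵢ` in the image of `α`, one has `n ⊗ s = ∑ n ⊗ λ(aᵢ) qᵢ s = ∑ n aᵢ ⊗ qᵢ s`.
    obtain ⟨m, a, q, ha, h1⟩ := hG.exists_sum_eq_one (hd n)
    choose p hp using fun i => Submodule.mem_colon_singleton.1 (ha i)
    refine ⟨∑ i, BaseChange.tmul _ (q i * s) (p i), ?_⟩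
    rw [map_sum]
    calc _ = ∑ i, BaseChange.tmul _ (toQuotientRing G (unop (a i)) * (q i * s)) n :=
          Finset.sum_congr rfl fun i _ => by
            rw [BaseChange.baseChangeMap_tmul, hp, BaseChange.mul_tmul, op_unop]
      _ = _ := by
          simp only [← BaseChange.sum_tmul, ← mul_assoc]
          rw [← Finset.sum_mul, h1, one_mul]
  | add x y hx hy =>
    obtain ⟨x, rfl⟩ := hx
    obtain ⟨y, rfl⟩ := hy
    exact ⟨x + y, map_add _ _ _⟩

/-- If `α` is injective with a torsion cokernel and a finitely generated projective domain, then
`α ⊗_R Q_G` is injective. -/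
theorem injective_baseChangeMap {P N : Type u} [AddCommGroup P] [Module Rᵐᵒᵖ P]
    [Module.Finite Rᵐᵒᵖ P] [Module.Projective Rᵐᵒᵖ P] [AddCommGroup N] [Module Rᵐᵒᵖ N]
    {α : P →ₗ[Rᵐᵒᵖ] N} (hα : Function.Injective α) (hd : IsDense G (LinearMap.range α)) :
    Function.Injective (baseChangeMap (toQuotientRing G) α) := by
  obtain ⟨n, f, hf⟩ := Module.Finite.exists_fin' Rᵐᵒᵖ P
  obtain ⟨s, hs⟩ := f.exists_rightInverse_of_surjective (LinearMap.range_eq_top.2 hf)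
  -- The images of the standard basis vectors and the coordinates of `s` form a dual basis of `P`.
  have hs' : ∀ p, ∑ i, s p i • f (Pi.single i 1) = p := fun p => by
    calc ∑ i, s p i • f (Pi.single i 1) = f (∑ i, Pi.single i (s p i)) := by
          rw [map_sum]
          exact Finset.sum_congr rfl fun i _ => by
            rw [← map_smul, ← Pi.single_smul, smul_eq_mul, mul_one]
      _ = p := by
          rw [LinearMap.sum_single_apply]
          exact LinearMap.congr_fun hs p
  let h : Fin n → P →ₗ[Rᵐᵒᵖ] QuotientRing G := fun i =>
    { toFun := fun p => toQuotientRing G (unop (s p i))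
      map_add' := fun p p' => by simp
      map_smul' := fun r p => by
        rw [map_smul, RingHom.id_apply, smul_toQuotientRing]
        rfl }
  choose g hg using fun i => (isGClosed_quotientRing G).exists_extension hα hd (h i)
  obtain ⟨h', hh', hh'_apply⟩ : ∃ h' : Fin n → P →+ QuotientRing G,
      (∀ i (r : R) x, h' i (op r • x) = h' i x * toQuotientRing G r) ∧
      ∀ i p, h' i p = toQuotientRing G (unop (s p i)) :=
    ⟨fun i => (h i).toAddMonoidHom, fun i r x => map_smul (h i) (op r) x, fun _ _ => rfl⟩
  obtain ⟨g', hg', hgh'⟩ : ∃ g' : Fin n → N →+ QuotientRing G,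
      (∀ i (r : R) x, g' i (op r • x) = g' i x * toQuotientRing G r) ∧
      ∀ i p, g' i (α p) = h' i p :=
    ⟨fun i => (g i).toAddMonoidHom, fun i r x => map_smul (g i) (op r) x,
      fun i p => (hg i p).trans (hh'_apply i p).symm⟩
  -- The dual basis identity survives in `P ⊗ Q_G`, so `x` is determined by the lifts of the `h' i`.
  -- These factor through `α ⊗ Q_G`, because each `h' i` extends to `N`.
  have key : ∀ x : BaseChange (toQuotientRing G) P,
      ∑ i, BaseChange.tmul _ (BaseChange.lift (h' i) (hh' i) x) (f (Pi.single i 1)) = x := by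
    intro x
    induction x using BaseChange.induction with
    | zero => simp [BaseChange.zero_tmul]
    | tmul t p =>
      nth_rewrite 2 [← hs' p]
      rw [BaseChange.tmul_sum]
      refine Finset.sum_congr rfl fun i _ => ?_
      rw [BaseChange.lift_tmul, ← op_unop (s p i), ← BaseChange.mul_tmul, hh'_apply]
    | add x y hx hy =>
      nth_rewrite 2 [← hx, ← hy]
      simp only [map_add, BaseChange.add_tmul, Finset.sum_add_distrib]
  rw [injective_iff_map_eq_zero]
  intro x hx
  rw [← key x]
  refine Finset.sum_eq_zero fun i _ => ?_
  rw [← BaseChange.lift_baseChangeMap α (g' i) (hg' i) _ (hh' i) (hgh' i), hx, map_zero,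
    BaseChange.zero_tmul]

theorem IsPerfect.isInverting (hG : IsPerfect G)
    {T F : CategoryTheory.ObjectProperty (ModuleCat.{u} Rᵐᵒᵖ)}
    (hTF : IsHereditaryTorsionPair T F) (hGT : CorrespondsTo G T)
    {W : CategoryTheory.MorphismProperty (ModuleCat.{u} Rᵐᵒᵖ)}
    (hW : IsResolvingFor W (finitelyPresentedIn T)) : IsInverting (toQuotientRing G) W := by
  intro P Q α hα
  obtain ⟨⟨_, _⟩, -, hinj, -⟩ := hW.of_mem α hα
  have hd := hW.isDense_range hTF hGT hα
  exact ⟨injective_baseChangeMap hinj hd, hG.surjective_baseChangeMap hd⟩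

end Perfect

/-! ### Homomorphisms inverting the resolutions -/

section Inverting

variable {G : IdealFilter Rᵐᵒᵖ} {S : Type u} [Ring S] {ψ : R →+* S}
  {T F : CategoryTheory.ObjectProperty (ModuleCat.{u} Rᵐᵒᵖ)}
  {W : CategoryTheory.MorphismProperty (ModuleCat.{u} Rᵐᵒᵖ)}

/-- If `ψ : R → S` inverts `W`, then maps from a finitely generated `I ∈ G` to `S` extend uniquely
to `R`. -/
theorem bijective_domRestrict_of_isInverting [Module Rᵐᵒᵖ S]
    (hS : ∀ (r : R) (s : S), op r • s = s * ψ r) (hGT : CorrespondsTo G T)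
    (hW : IsResolvingFor W (finitelyPresentedIn T)) (hψ : IsInverting ψ W)
    {I : Ideal Rᵐᵒᵖ} (hI : I ∈ G) (hfg : I.FG) :
    Function.Bijective fun g : Rᵐᵒᵖ →ₗ[Rᵐᵒᵖ] S => g.domRestrict I := by
  have hU : finitelyPresentedIn T (ModuleCat.of Rᵐᵒᵖ (Rᵐᵒᵖ ⧸ I)) :=
    ⟨(hGT I).1 hI, Module.finitePresentation_of_surjective I.mkQ I.mkQ_surjective
      (by rwa [Submodule.ker_mkQ])⟩
  obtain ⟨P, N, α, β, hα, hβ, hex⟩ := hW.exists_resolution _ hU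
  obtain ⟨-, ⟨-, hN⟩, -, -⟩ := hW.of_mem α hα
  have hinv := hψ α hα
  let β' : N →ₗ[Rᵐᵒᵖ] Rᵐᵒᵖ ⧸ I := β.hom
  -- Compare the given resolution of `R/I` with `I → R → R/I`: projectivity of `N` and `R` lifts the
  -- identity of `R/I` to `b : N → R` and `c : R → N`.
  obtain ⟨b, hb⟩ := Module.projective_lifting_property I.mkQ β' I.mkQ_surjective
  obtain ⟨c, hc⟩ := Module.projective_lifting_property β' I.mkQ hβ
  have hb' : ∀ n, I.mkQ (b n) = β' n := LinearMap.congr_fun hb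
  have hc' : ∀ x, β' (c x) = I.mkQ x := LinearMap.congr_fun hc
  constructor
  · intro g g' hgg'
    have hle : I ≤ LinearMap.ker (g - g') := fun a ha => by
      rw [LinearMap.mem_ker, LinearMap.sub_apply, sub_eq_zero]
      exact LinearMap.congr_fun hgg' ⟨a, ha⟩
    -- The difference factors through `R/I`; pulled back to `N` it vanishes on the image of `α`,
    -- hence everywhere.
    let k : N →ₗ[Rᵐᵒᵖ] S := I.liftQ (g - g') hle ∘ₗ β'
    have hk : ∀ n, k n = 0 := BaseChange.eq_zero_of_comp_eq_zero hinv.2 (g := k.toAddMonoidHom)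
      (fun r n => (map_smul k (op r) n).trans (hS r _)) fun p => by
        change I.liftQ (g - g') hle (β.hom (α.hom p)) = 0
        rw [(hex _).2 ⟨p, rfl⟩, map_zero]
    ext
    obtain ⟨n, hn⟩ := hβ (I.mkQ 1)
    have h1 : I.liftQ (g - g') hle (I.mkQ 1) = 0 := by
      rw [← hn]; exact hk n
    rw [Submodule.mkQ_apply, Submodule.liftQ_apply, LinearMap.sub_apply, sub_eq_zero] at h1
    exact h1
  · intro h
    have hbα : ∀ p, b (α.hom p) ∈ I := fun p => by
      rw [← Submodule.Quotient.mk_eq_zero]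
      exact (hb' _).trans ((hex _).2 ⟨p, rfl⟩)
    let k : P →ₗ[Rᵐᵒᵖ] S := h ∘ₗ (b ∘ₗ α.hom).codRestrict I hbα
    obtain ⟨g, hg, hgα⟩ := BaseChange.exists_extension hinv k.toAddMonoidHom fun r p => by
      exact (map_smul k (op r) p).trans (hS r _)
    let g' : N →ₗ[Rᵐᵒᵖ] S := 
      { g with map_smul' := fun r n => (hg (unop r) n).trans (hS (unop r) (g n)).symm }
    have hbc : ∀ x, b (c x) - x ∈ I := fun x => by
      rw [← Submodule.Quotient.mk_eq_zero, Submodule.Quotient.mk_sub, sub_eq_zero]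
      exact (hb' _).trans (hc' x)
    -- For `x ∈ I` the element `c x` lies in the image of `α`, where `g'` agrees with `h ∘ b`.
    -- Subtracting `h (b (c x) - x)` corrects `h (b (c x))` to `h x`.
    refine ⟨g' ∘ₗ c - h ∘ₗ (b ∘ₗ c - LinearMap.id).codRestrict I hbc, ?_⟩
    ext ⟨x, hx⟩
    obtain ⟨p, hp⟩ := (hex (c x)).1 ((hc' x).trans ((Submodule.Quotient.mk_eq_zero I).2 hx))
    have h1 : g' (c x) = h ⟨b (c x), by rw [← hp]; exact hbα p⟩ := by
      simp only [← hp]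
      exact hgα p
    simp only [LinearMap.domRestrict_apply, LinearMap.sub_apply, LinearMap.comp_apply]
    rw [h1, ← map_sub]
    congr 1
    ext
    simp

/-- If `G` is perfect and `ψ : R → S` inverts `W`, then `S` is `G`-closed. -/
theorem IsPerfect.isGClosed_of_isInverting [G.IsGabriel] (hG : IsPerfect G) [Module Rᵐᵒᵖ S]
    (hS : ∀ (r : R) (s : S), op r • s = s * ψ r) (hGT : CorrespondsTo G T)
    (hW : IsResolvingFor W (finitelyPresentedIn T)) (hψ : IsInverting ψ W) : IsGClosed G S := by
  have hinj : ∀ I ∈ G, Function.Injective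
      fun g : Rᵐᵒᵖ →ₗ[Rᵐᵒᵖ] S => g.domRestrict I := by
    intro I hI g g' h
    obtain ⟨J, hJ, hfg, hJI⟩ := hG.exists_fg_le hI
    refine (bijective_domRestrict_of_isInverting hS hGT hW hψ hJ hfg).1 ?_
    ext x
    exact LinearMap.congr_fun h ⟨x, hJI x.2⟩
  refine fun I hI => ⟨hinj I hI, fun h => ?_⟩
  obtain ⟨J, hJ, hfg, hJI⟩ := hG.exists_fg_le hI
  obtain ⟨g, hg⟩ := (bijective_domRestrict_of_isInverting hS hGT hW hψ hJ hfg).2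
    (h ∘ₗ Submodule.inclusion hJI)
  have hg' : ∀ a (ha : a ∈ J), g a = h ⟨a, hJI ha⟩ := fun a ha => LinearMap.congr_fun hg ⟨a, ha⟩
  refine ⟨g, ?_⟩
  ext x
  -- Multiplied by any `a` with `a • x ∈ J`, both `g x` and `h x` become `h (a • x)`. The ideal `(J
  -- : x)` of such `a` lies in `G` but need not be finitely generated, so injectivity is needed for
  -- all of `G`.
  have h0 : LinearMap.toSpanSingleton Rᵐᵒᵖ S (g x) = LinearMap.toSpanSingleton Rᵐᵒᵖ S (h x) := by
    apply hinj _ (IdealFilter.IsUniform.colon_mem hJ (x : Rᵐᵒᵖ))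
    ext ⟨a, ha⟩
    rw [Submodule.mem_colon_singleton] at ha
    simp only [LinearMap.domRestrict_apply, LinearMap.toSpanSingleton_apply]
    rw [← map_smul, ← map_smul, hg' _ ha]
    rfl
  simpa using LinearMap.congr_fun h0 1

/-- If `G` is perfect, then every `ψ : R → S` inverting `W` factors uniquely through `λ_G`. -/
theorem IsPerfect.existsUnique_comp_toQuotientRing [G.IsGabriel] (hG : IsPerfect G)
    (hGT : CorrespondsTo G T) (hW : IsResolvingFor W (finitelyPresentedIn T))
    (hψ : IsInverting ψ W) : ∃! φ : QuotientRing G →+* S, φ.comp (toQuotientRing G) = ψ := by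
  let _ : Module Rᵐᵒᵖ S := Module.compHom S ψ.op
  have hS : ∀ (r : R) (s : S), op r • s = s * ψ r := fun _ _ => rfl
  have hclosed := hG.isGClosed_of_isInverting hS hGT hW hψ
  let mulLeft : S → R →ₗ[Rᵐᵒᵖ] S := fun s =>
    { toFun := fun r => s * ψ r
      map_add' := fun r r' => by rw [map_add, mul_add]
      map_smul' := fun r r' => by
        rw [← op_unop r, op_smul_eq_mul, map_mul, RingHom.id_apply, hS, mul_assoc] }
  -- Each map `r ↦ s ψ(r)` extends uniquely to `Q_G`. The case `s = 1` defines `φ` and gives its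
  -- uniqueness; the case `s = φ q` gives multiplicativity, since `x ↦ φ(q x)` and `x ↦ φ(q) φ(x)`
  -- both extend `r ↦ φ(q) ψ(r)`.
  have hext := fun s => existsUnique_extension G hclosed (mulLeft s)
  obtain ⟨φ, hφ, hφ'⟩ := hext 1
  have hφ : ∀ r, φ (toQuotientRing G r) = ψ r := fun r => (hφ r).trans (one_mul _)
  have hsmul : ∀ q r, φ (q * toQuotientRing G r) = φ q * ψ r := fun q r => map_smul φ (op r) q
  have hmul : ∀ q q', φ (q * q') = φ q * φ q' := by
    intro q q'
    let f₁ : QuotientRing G →ₗ[Rᵐᵒᵖ] S :=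
      { toFun := fun x => φ (q * x)
        map_add' := fun x y => by rw [mul_add, map_add]
        map_smul' := fun r x => by
          change φ (q * (x * toQuotientRing G (unop r))) = φ (q * x) * ψ (unop r)
          rw [← mul_assoc, hsmul] }
    let f₂ : QuotientRing G →ₗ[Rᵐᵒᵖ] S :=
      { toFun := fun x => φ q * φ x
        map_add' := fun x y => by rw [map_add, mul_add]
        map_smul' := fun r x => by
          change φ q * φ (x * toQuotientRing G (unop r)) = φ q * φ x * ψ (unop r)
          rw [hsmul, mul_assoc] }
    have h : f₁ = f₂ := (hext (φ q)).unique (fun r => hsmul q r) fun r => by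
      change φ q * φ (toQuotientRing G r) = φ q * ψ r
      rw [hφ]
    exact LinearMap.congr_fun h q'
  refine ⟨{ φ.toAddMonoidHom with
    map_one' := (congrArg φ (map_one (toQuotientRing G)).symm).trans ((hφ 1).trans (map_one ψ))
    map_mul' := hmul }, RingHom.ext hφ, fun χ hχ => ?_⟩
  have hχ : ∀ r, χ (toQuotientRing G r) = ψ r := RingHom.congr_fun hχ
  let χ' : QuotientRing G →ₗ[Rᵐᵒᵖ] S :=
    { toFun := χ
      map_add' := map_add χ
      map_smul' := fun r x => by
        change χ (x * toQuotientRing G (unop r)) = χ x * ψ (unop r)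
        rw [map_mul, hχ] }
  ext q
  exact LinearMap.congr_fun (hφ' χ' fun r => (hχ r).trans (one_mul _).symm) q

/-- If `G` is perfect, then `λ_G` is a universal localization at any class of resolutions of the
finitely presented torsion modules. -/
theorem IsPerfect.isUniversalLocalization [G.IsGabriel] (hG : IsPerfect G)
    (hTF : IsHereditaryTorsionPair T F) (hGT : CorrespondsTo G T)
    (hW : IsResolvingFor W (finitelyPresentedIn T)) :
    IsUniversalLocalization (toQuotientRing G) W :=
  ⟨hG.isInverting hTF hGT hW, fun _ _ _ hψ => hG.existsUnique_comp_toQuotientRing hGT hW hψ⟩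

end Inverting

/-! ### Uniqueness and the main theorem -/

/-- Universal localizations at the same class of morphisms are equivalent. -/
theorem IsUniversalLocalization.areEquivalent {S S' : Type u} [Ring S] [Ring S'] {lam : R →+* S}
    {lam' : R →+* S'} {W : CategoryTheory.MorphismProperty (ModuleCat.{u} Rᵐᵒᵖ)}
    (h : IsUniversalLocalization lam W) (h' : IsUniversalLocalization lam' W) :
    AreEquivalent lam lam' := by
  obtain ⟨φ, hφ, -⟩ := h.2 S' lam' h'.1
  obtain ⟨χ, hχ, -⟩ := h'.2 S lam h.1
  refine ⟨RingEquiv.ofRingHom φ χ ?_ ?_, hφ.symm⟩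
  · exact (h'.2 S' lam' h'.1).unique (by rw [RingHom.comp_assoc, hχ, hφ]) (RingHom.id_comp _)
  · exact (h.2 S lam h.1).unique (by rw [RingHom.comp_assoc, hφ, hχ]) (RingHom.id_comp _)

end PerfectLocalization

theorem proposition4p4 {R : Type u} [Ring R]
    (hR : PerfectLocalization.IsRightSemihereditary R)
    (G : IdealFilter Rᵐᵒᵖ) [G.IsGabriel] (hG : PerfectLocalization.IsPerfect G)
    (T F : CategoryTheory.ObjectProperty (ModuleCat.{u} Rᵐᵒᵖ))
    (hTF : PerfectLocalization.IsHereditaryTorsionPair T F)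
    (hGT : PerfectLocalization.CorrespondsTo G T) :
    PerfectLocalization.IsRingEpimorphism (PerfectLocalization.toQuotientRing G) ∧
    (∃ (S : Type u) (_ : Ring S) (lam : R →+* S),
      PerfectLocalization.IsUniversalLocalizationAt lam
        (PerfectLocalization.finitelyPresentedIn T)) ∧
    ∀ (S : Type u) [Ring S] (lam : R →+* S),
      PerfectLocalization.IsUniversalLocalizationAt lam
        (PerfectLocalization.finitelyPresentedIn T) →
      PerfectLocalization.AreEquivalent (PerfectLocalization.toQuotientRing G) lam := by
  -- A localization at the class of modules comes with its own choice of `W`. As `λ_G` is universal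
  -- for every such `W`, the comparison takes place at that one.
  refine ⟨hG.isRingEpimorphism, ?_, fun S _ lam ⟨W, hW, hlam⟩ =>
    (hG.isUniversalLocalization hTF hGT hW).areEquivalent hlam⟩
  obtain ⟨W, hW⟩ := PerfectLocalization.exists_isResolvingFor hR T
  exact ⟨_, _, PerfectLocalization.toQuotientRing G, W, hW,
    hG.isUniversalLocalization hTF hGT hW⟩
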